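/- Let $\mathcal{M}$ be a von Neumann algebra on a complex Hilbert space $\mathcal{H}$ (for instance the local algebra $\mathcal{A}(\mathcal{O})$ of a spacetime region $\mathcal{O}$ acting on the vacuum Hilbert space), and let $\Omega\in\mathcal{H}$ be a unit vector (the vacuum) that is cyclic and separating for $\mathcal{M}$. Let $\overline S$ be the closure of the antilinear Tomita operator $S(A\Omega)=A^*\Omega$, $A\in\mathcal{M}$, let $\Delta=\overline S^{\,*}\,\overline S$ be the modular operator, so that $\overline S=J\Delta^{1/2}$ is the polar decomposition, and let $K=-\log\Delta$ be the modular Hamiltonian. For a unit vector $\psi$ let $\mu_\psi$ be the spectral probability measure of $K$ in the state $\psi$; the expectation $\langle K\rangle_\psi=\int x\,d\mu_\psi(x)$ is called finite if $\int |x|\,d\mu_\psi(x)<\infty$. Let $A\in\mathcal{M}$ and set $\xi=A\Omega$. Then $\xi$ lies in the domain of $\Delta^{1/2}$ and $$\|A\|\ \ge\ \|\Delta^{1/2}\xi\|.$$ If moreover $\xi\neq 0$, $\hat\xi=\xi/\|\xi\|$, and $\langle K\rangle_{\hat\xi}$ is finite, then $$\|A\|\ \ge\ \|\xi\|\,\exp\!\left[-\tfrac12\langle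 K\rangle_{\hat\xi}\right].$$ -/

import Mathlib

open MeasureTheory
open scoped CompactlySupported

namespace ModularTheory

/-! ### The Tomita operator and the modular operator -/

section Tomita

variable {H : Type*} [NormedAddCommGroup H] [InnerProductSpace ℂ H] [CompleteSpace H]

/-- `Ω` is cyclic for `M`: the subspace `M Ω` is dense. -/
def IsCyclic (M : VonNeumannAlgebra H) (Ω : H) : Prop :=
  Dense {x : H | ∃ a ∈ M, a Ω = x}

/-- `Ω` is separating for `M`: the map `a ↦ a Ω` is injective on `M`. -/
def IsSeparating (M : VonNeumannAlgebra H) (Ω : H) : Prop :=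
  ∀ a ∈ M, ∀ b ∈ M, a Ω = b Ω → a = b

/-- The graph of the Tomita operator `S (a Ω) = a⋆ Ω`, `a ∈ M`. -/
def tomitaGraph (M : VonNeumannAlgebra H) (Ω : H) : Set (H × H) :=
  {p | ∃ a ∈ M, p = (a Ω, star a Ω)}

/-- The graph of the closure of the Tomita operator. -/
def closedTomitaGraph (M : VonNeumannAlgebra H) (Ω : H) : Set (H × H) :=
  closure (tomitaGraph M Ω)

/-- The graph of the adjoint of a densely defined antilinear operator with graph `G`:
`(y, w)` belongs to it iff `⟪S z, y⟫ = ⟪w, z⟫` for all `z` in the domain of `S`. -/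
def antilinearAdjointGraph (G : Set (H × H)) : Set (H × H) :=
  {p | ∀ q ∈ G, inner ℂ q.2 p.1 = inner ℂ p.2 q.1}

theorem closedTomitaGraph_add {M : VonNeumannAlgebra H} {Ω : H} {p q : H × H}
    (hp : p ∈ closedTomitaGraph M Ω) (hq : q ∈ closedTomitaGraph M Ω) :
    p + q ∈ closedTomitaGraph M Ω := by
  refine map_mem_closure₂ continuous_add hp hq ?_
  rintro _ ⟨a, ha, rfl⟩ _ ⟨b, hb, rfl⟩
  exact ⟨a + b, add_mem ha hb, by simp⟩

theorem closedTomitaGraph_smul {M : VonNeumannAlgebra H} {Ω : H} (c : ℂ) {p : H × H}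
    (hp : p ∈ closedTomitaGraph M Ω) :
    (c • p.1, (starRingEnd ℂ) c • p.2) ∈ closedTomitaGraph M Ω := by
  have hc : Continuous fun p : H × H => (c • p.1, (starRingEnd ℂ) c • p.2) := by fun_prop
  refine map_mem_closure (f := fun p : H × H => (c • p.1, (starRingEnd ℂ) c • p.2)) hc hp ?_
  rintro _ ⟨a, ha, rfl⟩
  exact ⟨c • a, M.toStarSubalgebra.smul_mem ha c, by simp⟩

/-- The graph of the modular operator `Δ = S⋆ S`, where `S` is the closed Tomita operator. -/
def modularGraph (M : VonNeumannAlgebra H) (Ω : H) : Submodule ℂ (H × H) where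
  carrier := {p | ∃ y : H, (p.1, y) ∈ closedTomitaGraph M Ω ∧
    (y, p.2) ∈ antilinearAdjointGraph (closedTomitaGraph M Ω)}
  zero_mem' := ⟨0, subset_closure ⟨0, zero_mem M, by simp⟩, fun q _ => by simp⟩
  add_mem' := by
    rintro p q ⟨y, hy, hy'⟩ ⟨z, hz, hz'⟩
    refine ⟨y + z, closedTomitaGraph_add hy hz, fun r hr => ?_⟩
    have h1 := hy' r hr
    have h2 := hz' r hr
    simp only [Prod.snd_add, inner_add_left, inner_add_right] at h1 h2 ⊢
    rw [h1, h2]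
  smul_mem' := by
    rintro c p ⟨y, hy, hy'⟩
    refine ⟨(starRingEnd ℂ) c • y, closedTomitaGraph_smul c hy, fun r hr => ?_⟩
    have h1 := hy' r hr
    simp only [Prod.smul_snd, inner_smul_left, inner_smul_right] at h1 ⊢
    rw [h1]

/-- The modular operator `Δ = S⋆ S` of the pair `(M, Ω)`, as an unbounded operator. -/
noncomputable def modularOperator (M : VonNeumannAlgebra H) (Ω : H) : H →ₗ.[ℂ] H :=
  (modularGraph M Ω).toLinearPMap

/-- A separating vector for `M` is cyclic for the commutant of `M`. -/
theorem dense_commutant {M : VonNeumannAlgebra H} {Ω : H} (hs : IsSeparating M Ω) :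
    Dense {x : H | ∃ b ∈ M.commutant, b Ω = x} := by
  let V : Submodule ℂ H :=
    { carrier := {x : H | ∃ b ∈ M.commutant, b Ω = x}
      zero_mem' := ⟨0, zero_mem _, by simp⟩
      add_mem' := by
        rintro _ _ ⟨a, ha, rfl⟩ ⟨b, hb, rfl⟩
        exact ⟨a + b, add_mem ha hb, by simp⟩
      smul_mem' := by
        rintro c _ ⟨a, ha, rfl⟩
        exact ⟨c • a, M.commutant.toStarSubalgebra.smul_mem ha c, by simp⟩ }
  let W := V.topologicalClosure
  have hWc : _root_.IsClosed (W : Set H) := V.isClosed_topologicalClosure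
  have : CompleteSpace W := hWc.completeSpace_coe
  have hP : W.starProjection ∈ M := by
    rw [VonNeumannAlgebra.IsStarProjection.mem_iff isStarProjection_starProjection]
    intro y hy
    have hr : (W.starProjection).range = W := Submodule.range_starProjection W
    rw [hr, Module.End.mem_invtSubmodule]
    intro x hx
    refine map_mem_closure y.continuous (s := (V : Set H)) (t := (V : Set H)) hx ?_
    rintro _ ⟨b, hb, rfl⟩
    exact ⟨y * b, mul_mem hy hb, rfl⟩
  have h1 : W.starProjection = 1 := by
    refine hs _ hP _ (one_mem M) ?_
    have hΩ : Ω ∈ W := V.le_topologicalClosure ⟨1, one_mem _, rfl⟩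
    simpa using Submodule.starProjection_eq_self_iff.mpr hΩ
  intro x
  have : W.starProjection x ∈ W := Submodule.starProjection_apply_mem W x
  rw [h1] at this
  exact this

/-- The Tomita operator is closable: the closure of its graph is the graph of a function. -/
theorem closedTomitaGraph_snd_eq_zero {M : VonNeumannAlgebra H} {Ω : H} (hs : IsSeparating M Ω)
    {y : H} (hy : ((0 : H), y) ∈ closedTomitaGraph M Ω) : y = 0 := by
  have key : ∀ b ∈ M.commutant, ∀ p ∈ closedTomitaGraph M Ω,
      inner ℂ (b Ω) p.2 = inner ℂ p.1 (star b Ω) := by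
    intro b hb p hp
    have hcl : _root_.IsClosed {p : H × H | inner ℂ (b Ω) p.2 = inner ℂ p.1 (star b Ω)} :=
      isClosed_eq (by fun_prop) (by fun_prop)
    refine closure_minimal ?_ hcl hp
    rintro _ ⟨a, ha, rfl⟩
    have hab : a * b = b * a := VonNeumannAlgebra.mem_commutant_iff.mp hb a ha
    change inner ℂ (b Ω) (star a Ω) = inner ℂ (a Ω) (star b Ω)
    rw [ContinuousLinearMap.star_eq_adjoint, ContinuousLinearMap.star_eq_adjoint,
      ContinuousLinearMap.adjoint_inner_right, ContinuousLinearMap.adjoint_inner_right]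
    exact congrArg (fun f : H →L[ℂ] H => inner ℂ (f Ω) Ω) hab
  refine (dense_commutant hs).eq_zero_of_inner_right ℂ ?_
  rintro _ ⟨b, hb, rfl⟩
  simpa using key b hb _ hy

/-- The graph of `Δ` is the graph of a function. -/
theorem modularGraph_snd_eq_zero {M : VonNeumannAlgebra H} {Ω : H} (hc : IsCyclic M Ω)
    (hs : IsSeparating M Ω) (p : H × H) (hp : p ∈ modularGraph M Ω) (h0 : p.1 = 0) :
    p.2 = 0 := by
  obtain ⟨y, hy, hy'⟩ := hp
  rw [h0] at hy
  obtain rfl := closedTomitaGraph_snd_eq_zero hs hy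
  refine hc.eq_zero_of_inner_left ℂ ?_
  rintro _ ⟨a, ha, rfl⟩
  have := hy' (a Ω, star a Ω) (subset_closure ⟨a, ha, rfl⟩)
  simpa using this.symm

theorem mem_graph_modularOperator {M : VonNeumannAlgebra H} {Ω : H} (hc : IsCyclic M Ω)
    (hs : IsSeparating M Ω) (p : H × H) :
    p ∈ (modularOperator M Ω).graph ↔ ∃ y : H, (p.1, y) ∈ closedTomitaGraph M Ω ∧
      (y, p.2) ∈ antilinearAdjointGraph (closedTomitaGraph M Ω) := by
  rw [modularOperator, Submodule.toLinearPMap_graph_eq _ (modularGraph_snd_eq_zero hc hs)]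
  rfl

end Tomita

/-! ### Functional calculus of a positive self-adjoint operator -/

section FunctionalCalculus

variable {H : Type*} [NormedAddCommGroup H] [InnerProductSpace ℂ H] [CompleteSpace H]

/-- `R` is the everywhere defined bounded inverse of `1 + T`: the equation `x + T x = y` has,
for every `y`, exactly the solution `x = R y`. -/
def IsInvOneAdd (T : H →ₗ.[ℂ] H) (R : H →L[ℂ] H) : Prop :=
  ∀ x y : H, R y = x ↔ (x, y - x) ∈ T.graph

/-- For `T = Δ` the bounded inverse of `1 + T` exists. -/
theorem exists_isInvOneAdd_modularOperator {M : VonNeumannAlgebra H} {Ω : H} (hc : IsCyclic M Ω)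
    (hs : IsSeparating M Ω) : ∃ R : H →L[ℂ] H, IsInvOneAdd (modularOperator M Ω) R := by
  have h0 : ∀ x w : H, (x, w) ∈ (modularOperator M Ω).graph → 0 ≤ (inner ℂ w x).re := by
    intro x w h
    obtain ⟨z, hz, hz'⟩ := (mem_graph_modularOperator hc hs _).mp h
    have h1 := hz' _ hz
    simp only at h1
    rw [← h1]
    exact inner_self_nonneg (𝕜 := ℂ)
  have hex : ∀ y : H, ∃ x : H, (x, y - x) ∈ (modularOperator M Ω).graph := by
    intro y
    let _ : InnerProductSpace ℝ (WithLp 2 (H × H)) :=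
      InnerProductSpace.rclikeToReal ℂ (WithLp 2 (H × H))
    have hcl : _root_.IsClosed {p : WithLp 2 (H × H) | WithLp.ofLp p ∈ closedTomitaGraph M Ω} :=
      isClosed_closure.preimage (WithLp.prod_continuous_ofLp 2 H H)
    let G : Submodule ℝ (WithLp 2 (H × H)) :=
      { carrier := {p | WithLp.ofLp p ∈ closedTomitaGraph M Ω}
        zero_mem' := subset_closure ⟨0, zero_mem M, by simp; rfl⟩
        add_mem' := fun hp hq => closedTomitaGraph_add hp hq
        smul_mem' := fun c p hp => by
          have := closedTomitaGraph_smul (c : ℂ) hp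
          rw [Complex.conj_ofReal] at this
          exact this }
    have hGc : IsComplete (G : Set (WithLp 2 (H × H))) := IsClosed.isComplete hcl
    have : CompleteSpace G := completeSpace_coe_iff_isComplete.mpr hGc
    let g := G.starProjection (WithLp.toLp 2 (y, (0 : H)))
    have hg : WithLp.ofLp g ∈ closedTomitaGraph M Ω := G.starProjection_apply_mem _
    have hre : ∀ q ∈ closedTomitaGraph M Ω,
        (inner ℂ q.1 (y - g.fst)).re = (inner ℂ q.2 g.snd).re := by
      intro q hq
      have h := Submodule.starProjection_inner_eq_zero (K := G) (WithLp.toLp 2 (y, (0 : H)))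
        (WithLp.toLp 2 q) hq
      rw [real_inner_comm] at h
      change (inner ℂ (WithLp.toLp 2 q) (WithLp.toLp 2 (y, (0 : H)) - g)).re = 0 at h
      rw [WithLp.prod_inner_apply] at h
      simp [inner_sub_right] at h
      simp only [inner_sub_right, Complex.sub_re]
      linarith
    refine ⟨g.fst, (mem_graph_modularOperator hc hs _).mpr ⟨g.snd, hg, fun q hq => ?_⟩⟩
    have h1 := hre q hq
    have h2 := hre _ (closedTomitaGraph_smul Complex.I hq)
    simp only [inner_smul_left, Complex.conj_I, map_neg, neg_mul, Complex.neg_re, Complex.mul_re,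
      Complex.I_re, Complex.I_im, zero_mul, one_mul, zero_sub, neg_neg] at h2
    simp only
    rw [← inner_conj_symm (y - g.fst) q.1]
    apply Complex.ext
    · rw [Complex.conj_re]; exact h1.symm
    · rw [Complex.conj_im]; linarith
  have huniq : ∀ x x' y : H, (x, y - x) ∈ (modularOperator M Ω).graph →
      (x', y - x') ∈ (modularOperator M Ω).graph → x = x' := by
    intro x x' y h h'
    have h1 := h0 _ _ (Submodule.sub_mem _ h h')
    have h2 : y - x - (y - x') = -(x - x') := by abel
    rw [h2, inner_neg_left, Complex.neg_re] at h1
    have h3 : (inner ℂ (x - x') (x - x')).re = ‖x - x'‖ ^ 2 := by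
      rw [inner_self_eq_norm_sq_to_K]; norm_cast
    have h4 : ‖x - x'‖ = 0 := by
      rw [h3] at h1
      nlinarith [sq_nonneg ‖x - x'‖]
    exact sub_eq_zero.mp (norm_eq_zero.mp h4)
  choose f hf using hex
  let L : H →ₗ[ℂ] H :=
    { toFun := f
      map_add' := fun y y' => by
        refine huniq _ _ (y + y') (hf _) ?_
        have := Submodule.add_mem _ (hf y) (hf y')
        rwa [Prod.mk_add_mk, sub_add_sub_comm] at this
      map_smul' := fun c y => by
        refine huniq _ _ (c • y) (hf _) ?_
        have := Submodule.smul_mem _ c (hf y)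
        rwa [Prod.smul_mk, smul_sub] at this }
  refine ⟨L.mkContinuous 1 fun y => ?_, fun x y => ⟨?_, fun h => huniq _ _ y (hf y) h⟩⟩
  · have h1 := h0 _ _ (hf y)
    rw [inner_sub_left, Complex.sub_re] at h1
    have h2 : (inner ℂ (f y) (f y)).re = ‖f y‖ ^ 2 := by
      rw [inner_self_eq_norm_sq_to_K]; norm_cast
    have h3 : (inner ℂ y (f y)).re ≤ ‖y‖ * ‖f y‖ := re_inner_le_norm (𝕜 := ℂ) y (f y)
    change ‖f y‖ ≤ 1 * ‖y‖
    by_contra hcon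
    nlinarith [norm_nonneg (f y), norm_nonneg y]
  · rintro rfl
    exact hf y

open scoped Classical in
/-- The bounded operator `(1 + T)⁻¹` of a positive self-adjoint operator `T`. -/
noncomputable def invOneAdd (T : H →ₗ.[ℂ] H) : H →L[ℂ] H :=
  if h : ∃ R : H →L[ℂ] H, IsInvOneAdd T R then h.choose else 0

/-- The positive square root of a positive self-adjoint operator `T`. With `R = (1 + T)⁻¹`,
so `0 ≤ R ≤ 1`, it is `T^(1/2) = (1 - R)^(1/2) R^(-1/2)`, the operator with domain the range of
`R^(1/2)` and with `T^(1/2) (R^(1/2) v) = (1 - R)^(1/2) v`. -/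
noncomputable def sqrtOp (T : H →ₗ.[ℂ] H) : H →ₗ.[ℂ] H :=
  (LinearMap.range (((cfc Real.sqrt (invOneAdd T)).prod
    (cfc (fun r : ℝ => Real.sqrt (1 - r)) (invOneAdd T)) : H →L[ℂ] H × H) :
      H →ₗ[ℂ] H × H)).toLinearPMap

/-- The positive functional `f ↦ ⟪x, f(R) x⟫` for a bounded self-adjoint operator `R`. -/
noncomputable def spectralFunctional (R : H →L[ℂ] H) (x : H) : C_c(ℝ, ℝ) →ₚ[ℝ] ℝ :=
  PositiveLinearMap.mk₀
    { toFun := fun f => (inner ℂ x (cfc f R x)).re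
      map_add' := fun f g => by
        have h : cfc (⇑(f + g)) R = cfc (⇑f) R + cfc (⇑g) R :=
          cfc_add (a := R) f g f.continuous.continuousOn g.continuous.continuousOn
        rw [h]
        simp
      map_smul' := fun c f => by
        have h : cfc (⇑(c • f)) R = c • cfc (⇑f) R :=
          cfc_smul (a := R) c f f.continuous.continuousOn
        rw [h, smul_apply, RCLike.real_smul_eq_coe_smul (K := ℂ),
          inner_smul_right]
        simp }
    (fun f hf => by
      have h : 0 ≤ cfc (⇑f) R := cfc_nonneg fun r _ => hf r
      have h2 := ((ContinuousLinearMap.nonneg_iff_isPositive _).mp h).re_inner_nonneg_right x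
      simpa using h2)

/-- The spectral measure of a bounded self-adjoint operator `R` at the vector `x`: the Borel
measure `μ` on `ℝ` with `∫ f dμ = ⟪x, f(R) x⟫` for all continuous compactly supported `f`. -/
noncomputable def boundedSpectralMeasure (R : H →L[ℂ] H) (x : H) : Measure ℝ :=
  RealRMK.rieszMeasure (spectralFunctional R x)

/-- The spectral measure `B ↦ ⟪x, 1_B(T) x⟫` of a positive self-adjoint operator `T` at the
vector `x`. As `T = R⁻¹ - 1` with `R = (1 + T)⁻¹`, it is the image of the spectral measure of `R`
under `r ↦ r⁻¹ - 1` (the point `r = 0` is not charged, since `R` is injective). -/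
noncomputable def spectralMeasure (T : H →ₗ.[ℂ] H) (x : H) : Measure ℝ :=
  (boundedSpectralMeasure (invOneAdd T) x).map (fun r : ℝ => r⁻¹ - 1)

/-- The distribution of the modular Hamiltonian `K = -log Δ` in the vector state `x`: the image of
the spectral measure of `Δ` at `x` under `t ↦ -log t` (the point `t = 0` is not charged, since
`Δ` is injective). -/
noncomputable def modularEnergyMeasure (M : VonNeumannAlgebra H) (Ω x : H) : Measure ℝ :=
  (spectralMeasure (modularOperator M Ω) x).map (fun t : ℝ => -Real.log t)

/-- The expectation `⟨K⟩` of `K = -log Δ` in the vector state `x` is finite. -/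
def FiniteModularEnergy (M : VonNeumannAlgebra H) (Ω x : H) : Prop :=
  Integrable (fun k : ℝ => k) (modularEnergyMeasure M Ω x)

/-- The expectation `⟨K⟩` of `K = -log Δ` in the vector state `x`. -/
noncomputable def modularEnergy (M : VonNeumannAlgebra H) (Ω x : H) : ℝ :=
  ∫ k : ℝ, k ∂(modularEnergyMeasure M Ω x)

end FunctionalCalculus

end ModularTheory

/-!
Write `S` for the closed Tomita operator, `Δ = S⋆ S` and `R = (1 + Δ)⁻¹`. From `S (A Ω) = A⋆ Ω` one
has `‖S (A Ω)‖ ≤ ‖A‖`, so the first bound is the inclusion `dom S ⊆ dom Δ^(1/2)` together with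
`‖Δ^(1/2) x‖ ≤ ‖S x‖`. No polar decomposition is needed for it. For `y = S x`, the number `⟪u, x⟫`
is the inner product in the graph of `S` of `(R u, S (R u))` with `(x, y)`, and the first of these
two vectors has graph norm `‖R^(1/2) u‖`. Hence
`|⟪u, x⟫|² ≤ (‖x‖² + ‖y‖²) ‖R^(1/2) u‖²` (`norm_inner_sq_le_of_mem_closedTomitaGraph`), and by a
Douglas-type lemma (`exists_adjoint_apply_eq`) there is `v` with `x = R^(1/2) v` and
`‖v‖² ≤ ‖x‖² + ‖y‖²`. As `‖v‖² = ‖R^(1/2) v‖² + ‖(1 - R)^(1/2) v‖²` and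
`Δ^(1/2) x = (1 - R)^(1/2) v`, the bound follows (`exists_cfc_sqrt_apply_eq`).

The second bound is Jensen's inequality for the exponential function and the spectral measure `μ`
of `R` at the unit vector `x = A Ω / ‖A Ω‖`, under which `K = -log Δ` is the random variable
`-log(r⁻¹ - 1)`: `exp(-⟨K⟩) ≤ ∫ (r⁻¹ - 1) dμ ≤ ‖Δ^(1/2) x‖² ≤ ‖A‖² / ‖A Ω‖²`. The integral is
controlled by approximating `r⁻¹ - 1` from below (`lintegral_inv_sub_one_le`), and `μ` is carried by
the open interval `(0, 1)` because neither `0` nor `1` is an eigenvalue of `R`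
(`ae_mem_Ioo_boundedSpectralMeasure`): `R` is injective as `Δ` is
single-valued, and `1 - R` is injective because `S` is an involution.
-/

namespace ModularTheory

open Filter Topology

variable {H : Type*} [NormedAddCommGroup H] [InnerProductSpace ℂ H] [CompleteSpace H]

/-! ### The resolvent of the modular operator -/

section Resolvent

variable {M : VonNeumannAlgebra H} {Ω : H}

theorem isInvOneAdd_invOneAdd_modularOperator (hc : IsCyclic M Ω) (hs : IsSeparating M Ω) :
    IsInvOneAdd (modularOperator M Ω) (invOneAdd (modularOperator M Ω)) := by
  have h := exists_isInvOneAdd_modularOperator hc hs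
  rw [invOneAdd, dif_pos h]
  exact h.choose_spec

/-- With `R = (1 + Δ)⁻¹`, every `R u` lies in the domain of `Δ = S⋆ S`, and `Δ (R u) = u - R u`.
For `y = S (R u)`, the quadratic form of `Δ` at `R u` is `‖y‖²`, and `⟪R u, u⟫` is the square of the
graph norm of `(R u, y)`. -/
theorem exists_tomita_invOneAdd (hc : IsCyclic M Ω) (hs : IsSeparating M Ω) (u : H) :
    ∃ y : H, (invOneAdd (modularOperator M Ω) u, y) ∈ closedTomitaGraph M Ω ∧
      (y, u - invOneAdd (modularOperator M Ω) u) ∈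
        antilinearAdjointGraph (closedTomitaGraph M Ω) ∧
      inner ℂ (u - invOneAdd (modularOperator M Ω) u) (invOneAdd (modularOperator M Ω) u) =
        ((‖y‖ ^ 2 : ℝ) : ℂ) ∧
      inner ℂ (invOneAdd (modularOperator M Ω) u) u =
        ((‖y‖ ^ 2 + ‖invOneAdd (modularOperator M Ω) u‖ ^ 2 : ℝ) : ℂ) := by
  obtain ⟨y, hy, hy'⟩ := (mem_graph_modularOperator hc hs _).mp
    ((isInvOneAdd_invOneAdd_modularOperator hc hs _ u).mp rfl)
  set R := invOneAdd (modularOperator M Ω)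
  have h : inner ℂ (u - R u) (R u) = ((‖y‖ ^ 2 : ℝ) : ℂ) := by
    have h := hy' _ hy
    simp only at h
    rw [← h, inner_self_eq_norm_sq_to_K]
    norm_cast
  refine ⟨y, hy, hy', h, ?_⟩
  rw [← inner_conj_symm, ← sub_add_cancel u (R u), inner_add_left, sub_add_cancel, h,
    inner_self_eq_norm_sq_to_K]
  simp

theorem invOneAdd_modularOperator_nonneg (hc : IsCyclic M Ω) (hs : IsSeparating M Ω) :
    0 ≤ invOneAdd (modularOperator M Ω) := by
  rw [ContinuousLinearMap.nonneg_iff_isPositive, ContinuousLinearMap.isPositive_iff_complex]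
  intro u
  obtain ⟨y, -, -, -, h1⟩ := exists_tomita_invOneAdd hc hs u
  rw [h1]
  exact ⟨rfl, by simp only [RCLike.re_to_complex, Complex.ofReal_re]; positivity⟩

theorem invOneAdd_modularOperator_le_one (hc : IsCyclic M Ω) (hs : IsSeparating M Ω) :
    invOneAdd (modularOperator M Ω) ≤ 1 := by
  rw [← sub_nonneg, ContinuousLinearMap.nonneg_iff_isPositive,
    ContinuousLinearMap.isPositive_iff_complex]
  intro u
  obtain ⟨y, -, -, h, -⟩ := exists_tomita_invOneAdd hc hs u
  set R := invOneAdd (modularOperator M Ω)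
  have h1 : inner ℂ ((1 - R) u) u = ((‖y‖ ^ 2 + ‖u - R u‖ ^ 2 : ℝ) : ℂ) := by
    have h2 : inner ℂ (u - R u) u = inner ℂ (u - R u) (R u) + inner ℂ (u - R u) (u - R u) := by
      rw [← inner_add_right, add_sub_cancel]
    change inner ℂ (u - R u) u = _
    rw [h2, h, inner_self_eq_norm_sq_to_K]
    simp
  rw [h1]
  exact ⟨rfl, by simp only [RCLike.re_to_complex, Complex.ofReal_re]; positivity⟩

theorem eq_zero_of_invOneAdd_modularOperator_eq_zero (hc : IsCyclic M Ω) (hs : IsSeparating M Ω)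
    {u : H} (hu : invOneAdd (modularOperator M Ω) u = 0) : u = 0 := by
  have h := (isInvOneAdd_invOneAdd_modularOperator hc hs 0 u).mp hu
  rw [mem_graph_modularOperator hc hs] at h
  simpa using modularGraph_snd_eq_zero hc hs _ h rfl

/-- The Tomita operator is an involution. -/
theorem swap_mem_closedTomitaGraph {p : H × H} (hp : p ∈ closedTomitaGraph M Ω) :
    p.swap ∈ closedTomitaGraph M Ω := by
  refine map_mem_closure continuous_swap hp ?_
  rintro _ ⟨a, ha, rfl⟩
  exact ⟨star a, star_mem ha, by simp⟩

/-- The modular operator is injective: `Δ u = 0` forces `S u = 0`, and `S` is an involution. -/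
theorem eq_zero_of_invOneAdd_modularOperator_eq_self (hc : IsCyclic M Ω) (hs : IsSeparating M Ω)
    {u : H} (hu : invOneAdd (modularOperator M Ω) u = u) : u = 0 := by
  obtain ⟨y, hy, -, h, -⟩ := exists_tomita_invOneAdd hc hs u
  rw [hu, sub_self, inner_zero_left] at h
  have hy0 : y = 0 := by
    have : ‖y‖ ^ 2 = 0 := by exact_mod_cast h.symm
    simpa using this
  rw [hu, hy0] at hy
  exact closedTomitaGraph_snd_eq_zero hs (swap_mem_closedTomitaGraph hy)

/-- A Cauchy–Schwarz inequality in the graph of the closed Tomita operator: if `y = S x`, then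
`⟪u, x⟫` is the graph inner product of `(R u, S (R u))` with `(x, y)`, and the square of the graph
norm of `(R u, S (R u))` is `⟪R u, u⟫`. -/
theorem norm_inner_sq_le_of_mem_closedTomitaGraph (hc : IsCyclic M Ω) (hs : IsSeparating M Ω)
    {x y : H} (hxy : (x, y) ∈ closedTomitaGraph M Ω) (u : H) :
    ‖inner ℂ u x‖ ^ 2 ≤
      (‖x‖ ^ 2 + ‖y‖ ^ 2) * (inner ℂ (invOneAdd (modularOperator M Ω) u) u).re := by
  obtain ⟨z, -, hz', -, h⟩ := exists_tomita_invOneAdd hc hs u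
  set R := invOneAdd (modularOperator M Ω)
  have h1 : (inner ℂ (R u) u).re = ‖z‖ ^ 2 + ‖R u‖ ^ 2 := by
    rw [h, Complex.ofReal_re]
  have h2 : inner ℂ u x = inner ℂ y z + inner ℂ (R u) x := by
    have h3 := hz' _ hxy
    simp only at h3
    rw [h3, ← inner_add_left, sub_add_cancel]
  have h4 : ‖inner ℂ u x‖ ≤ ‖y‖ * ‖z‖ + ‖R u‖ * ‖x‖ := by
    rw [h2]
    exact (norm_add_le _ _).trans (add_le_add (norm_inner_le_norm _ _) (norm_inner_le_norm _ _))
  rw [h1]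
  calc ‖inner ℂ u x‖ ^ 2 ≤ (‖y‖ * ‖z‖ + ‖R u‖ * ‖x‖) ^ 2 := by gcongr
    _ ≤ _ := by nlinarith [sq_nonneg (‖y‖ * ‖R u‖ - ‖z‖ * ‖x‖)]

end Resolvent

/-! ### Positive contractions and their square roots -/

section Contraction

/-- A form of the Douglas lemma: a vector `x` whose functional `⟪x, ·⟫` is dominated by
`C ‖T ·‖` is in the range of the adjoint of `T`. -/
theorem exists_adjoint_apply_eq {T : H →L[ℂ] H} (hT : Function.Injective T) {x : H} {C : ℝ}
    (hC : 0 ≤ C) (h : ∀ u, ‖inner ℂ x u‖ ≤ C * ‖T u‖) :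
    ∃ v, ContinuousLinearMap.adjoint T v = x ∧ ‖v‖ ≤ C := by
  let e := LinearEquiv.ofInjective (T : H →ₗ[ℂ] H) hT
  let f : StrongDual ℂ (LinearMap.range (T : H →ₗ[ℂ] H)) :=
    (((innerSL ℂ x : H →L[ℂ] ℂ) : H →ₗ[ℂ] ℂ) ∘ₗ (e.symm : _ →ₗ[ℂ] H)).mkContinuous C (by
      intro w
      obtain ⟨u, rfl⟩ := e.surjective w
      have hu : ((e u : LinearMap.range (T : H →ₗ[ℂ] H)) : H) = T u := rfl
      simpa [hu] using h u)
  obtain ⟨g, hg, hgn⟩ := exists_extension_norm_eq _ f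
  refine ⟨(InnerProductSpace.toDual ℂ H).symm g, ?_, ?_⟩
  · refine ext_inner_right ℂ fun u => ?_
    rw [ContinuousLinearMap.adjoint_inner_left, InnerProductSpace.toDual_symm_apply]
    have hu : ((e u : LinearMap.range (T : H →ₗ[ℂ] H)) : H) = T u := rfl
    have := hg (e u)
    rw [hu] at this
    simpa [f] using this
  · rw [LinearIsometryEquiv.norm_map, hgn]
    exact LinearMap.mkContinuous_norm_le _ hC _

variable {R : H →L[ℂ] H}

theorem spectrum_subset_Icc (h0 : 0 ≤ R) (h1 : R ≤ 1) : spectrum ℝ R ⊆ Set.Icc 0 1 := by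
  have hsa : IsSelfAdjoint R := IsSelfAdjoint.of_nonneg h0
  have h1' : cfc (fun r : ℝ => r) R ≤ 1 := by rwa [cfc_id' ℝ R]
  exact fun r hr => ⟨spectrum_nonneg_of_nonneg h0 hr, (cfc_le_one_iff _ R).mp h1' r hr⟩

theorem adjoint_cfc (f : ℝ → ℝ) : ContinuousLinearMap.adjoint (cfc f R) = cfc f R :=
  (cfc_predicate f R : IsSelfAdjoint (cfc f R)).adjoint_eq

theorem norm_cfc_apply_sq {f : ℝ → ℝ} (hf : Continuous f) (v : H) :
    ‖cfc f R v‖ ^ 2 = (inner ℂ v (cfc (fun r => f r * f r) R v)).re := by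
  rw [cfc_mul f f R hf.continuousOn hf.continuousOn, mul_apply_eq_comp,
    ← ContinuousLinearMap.adjoint_inner_left, adjoint_cfc, inner_self_eq_norm_sq_to_K]
  norm_cast

theorem cfc_sqrt_mul_self (h0 : 0 ≤ R) (h1 : R ≤ 1) :
    cfc (fun r => Real.sqrt r * Real.sqrt r) R = R := by
  have hsa : IsSelfAdjoint R := IsSelfAdjoint.of_nonneg h0
  conv_rhs => rw [← cfc_id' ℝ R]
  exact cfc_congr fun r hr => Real.mul_self_sqrt (spectrum_subset_Icc h0 h1 hr).1

theorem norm_cfc_sqrt_apply_sq (h0 : 0 ≤ R) (h1 : R ≤ 1) (v : H) :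
    ‖cfc Real.sqrt R v‖ ^ 2 = (inner ℂ (R v) v).re := by
  rw [norm_cfc_apply_sq Real.continuous_sqrt, cfc_sqrt_mul_self h0 h1, ← inner_conj_symm,
    Complex.conj_re]

theorem norm_cfc_sqrt_one_sub_apply_sq (h0 : 0 ≤ R) (h1 : R ≤ 1) (v : H) :
    ‖cfc (fun r : ℝ => Real.sqrt (1 - r)) R v‖ ^ 2 =
      (inner ℂ v (cfc (fun r : ℝ => 1 - r) R v)).re := by
  have h : cfc (fun r : ℝ => Real.sqrt (1 - r) * Real.sqrt (1 - r)) R =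
      cfc (fun r : ℝ => 1 - r) R :=
    cfc_congr fun r hr => Real.mul_self_sqrt (sub_nonneg.mpr (spectrum_subset_Icc h0 h1 hr).2)
  rw [norm_cfc_apply_sq (by fun_prop), h]

theorem norm_cfc_sqrt_sq_add (h0 : 0 ≤ R) (h1 : R ≤ 1) (v : H) :
    ‖cfc Real.sqrt R v‖ ^ 2 + ‖cfc (fun r : ℝ => Real.sqrt (1 - r)) R v‖ ^ 2 = ‖v‖ ^ 2 := by
  have hsa : IsSelfAdjoint R := IsSelfAdjoint.of_nonneg h0
  rw [norm_cfc_sqrt_apply_sq h0 h1, norm_cfc_sqrt_one_sub_apply_sq h0 h1,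
    cfc_sub (fun _ : ℝ => (1 : ℝ)) (fun r => r) R, cfc_const_one ℝ R, cfc_id' ℝ R,
    ← inner_conj_symm, Complex.conj_re, ← Complex.add_re, ← inner_add_right]
  have : R v + (1 - R) v = v := by simp
  rw [this, inner_self_eq_norm_sq_to_K]
  norm_cast

theorem injective_cfc_sqrt (h0 : 0 ≤ R) (h1 : R ≤ 1) (hinj : ∀ u, R u = 0 → u = 0) :
    Function.Injective (cfc Real.sqrt R : H →L[ℂ] H) := by
  refine (injective_iff_map_eq_zero _).mpr fun u hu => hinj u ?_
  have h := cfc_mul Real.sqrt Real.sqrt R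
  rw [cfc_sqrt_mul_self h0 h1] at h
  rw [h, mul_apply_eq_comp, hu, map_zero]

end Contraction

/-! ### The domain of the square root of the modular operator -/

section SquareRoot

variable {M : VonNeumannAlgebra H} {Ω : H}

/-- The domain of the closed Tomita operator `S` is contained in that of `Δ^(1/2)`, and
`‖Δ^(1/2) x‖ ≤ ‖S x‖`; here `x = R^(1/2) v` and `Δ^(1/2) x = (1 - R)^(1/2) v`. -/
theorem exists_cfc_sqrt_apply_eq (hc : IsCyclic M Ω) (hs : IsSeparating M Ω)
    {x y : H} (hxy : (x, y) ∈ closedTomitaGraph M Ω) :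
    ∃ v, cfc Real.sqrt (invOneAdd (modularOperator M Ω)) v = x ∧
      ‖cfc (fun r : ℝ => Real.sqrt (1 - r)) (invOneAdd (modularOperator M Ω)) v‖ ≤ ‖y‖ := by
  have h0 := invOneAdd_modularOperator_nonneg hc hs
  have h1 := invOneAdd_modularOperator_le_one hc hs
  have hinj := injective_cfc_sqrt h0 h1 fun u hu =>
    eq_zero_of_invOneAdd_modularOperator_eq_zero hc hs hu
  obtain ⟨v, hv, hvn⟩ := exists_adjoint_apply_eq hinj (x := x)
    (Real.sqrt_nonneg (‖x‖ ^ 2 + ‖y‖ ^ 2)) (fun u => by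
      rw [norm_inner_symm,
        ← Real.sqrt_sq (norm_nonneg (cfc Real.sqrt (invOneAdd (modularOperator M Ω)) u)),
        norm_cfc_sqrt_apply_sq h0 h1, ← Real.sqrt_mul (by positivity)]
      exact Real.le_sqrt_of_sq_le (norm_inner_sq_le_of_mem_closedTomitaGraph hc hs hxy u))
  rw [adjoint_cfc] at hv
  refine ⟨v, hv, ?_⟩
  have h2 := norm_cfc_sqrt_sq_add h0 h1 v
  have h3 : ‖v‖ ^ 2 ≤ ‖x‖ ^ 2 + ‖y‖ ^ 2 := by
    rw [← Real.sq_sqrt (show 0 ≤ ‖x‖ ^ 2 + ‖y‖ ^ 2 by positivity)]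
    gcongr
  rw [hv] at h2
  exact le_of_abs_le (abs_le_of_sq_le_sq (by linarith) (norm_nonneg y))

/-- The range defining `Δ^(1/2)` is the graph of a function, as `R^(1/2)` is injective. -/
theorem mk_mem_graph_sqrtOp (hc : IsCyclic M Ω) (hs : IsSeparating M Ω) (v : H) :
    (cfc Real.sqrt (invOneAdd (modularOperator M Ω)) v,
      cfc (fun r : ℝ => Real.sqrt (1 - r)) (invOneAdd (modularOperator M Ω)) v) ∈
      (sqrtOp (modularOperator M Ω)).graph := by
  have hinj := injective_cfc_sqrt (invOneAdd_modularOperator_nonneg hc hs)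
    (invOneAdd_modularOperator_le_one hc hs) fun u hu =>
    eq_zero_of_invOneAdd_modularOperator_eq_zero hc hs hu
  rw [sqrtOp, Submodule.toLinearPMap_graph_eq]
  · exact ⟨v, rfl⟩
  · rintro _ ⟨w, rfl⟩ hw
    obtain rfl : w = 0 := hinj (by simpa using hw)
    simp

end SquareRoot

/-! ### The spectral measure of a positive contraction -/

section SpectralMeasure

variable {R : H →L[ℂ] H}

instance (x : H) : (boundedSpectralMeasure R x).Regular :=
  RealRMK.regular_rieszMeasure _

theorem boundedSpectralMeasure_compl_Icc (h0 : 0 ≤ R) (h1 : R ≤ 1) (x : H) :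
    boundedSpectralMeasure R x (Set.Icc 0 1)ᶜ = 0 := by
  rw [(isClosed_Icc.isOpen_compl).measure_eq_iSup_isCompact]
  simp only [ENNReal.iSup_eq_zero]
  intro K hK hKc
  obtain ⟨f, hf1, hf0, hfc, hf⟩ := exists_continuous_one_zero_of_isCompact hKc
    (isClosed_Icc (a := (0 : ℝ)) (b := 1)) (Set.disjoint_left.mpr hK)
  let g : C_c(ℝ, ℝ) := ⟨f, hfc⟩
  have hg : cfc (g : ℝ → ℝ) R = 0 := by
    rw [← cfc_const_zero ℝ R]
    exact cfc_congr fun r hr => hf0 (spectrum_subset_Icc h0 h1 hr)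
  have h2 : spectralFunctional R x g = 0 := by
    change (inner ℂ x (cfc (g : ℝ → ℝ) R x)).re = 0
    simp [hg]
  have h3 := RealRMK.rieszMeasure_le_of_eq_one (spectralFunctional R x) (f := g)
    (fun r => (hf r).1) hKc hf1
  rw [h2, ENNReal.ofReal_zero] at h3
  exact le_antisymm h3 bot_le

theorem ae_mem_Icc_boundedSpectralMeasure (h0 : 0 ≤ R) (h1 : R ≤ 1) (x : H) :
    ∀ᵐ r ∂boundedSpectralMeasure R x, r ∈ Set.Icc (0 : ℝ) 1 :=
  boundedSpectralMeasure_compl_Icc h0 h1 x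

/-- The defining property of the spectral measure, extended from compactly supported functions
to all continuous ones: the spectrum is compact. -/
theorem integral_boundedSpectralMeasure (h0 : 0 ≤ R) (h1 : R ≤ 1) (x : H) {f : ℝ → ℝ}
    (hf : Continuous f) :
    Integrable f (boundedSpectralMeasure R x) ∧
      ∫ r, f r ∂boundedSpectralMeasure R x = (inner ℂ x (cfc f R x)).re := by
  obtain ⟨χ, hχ1, -, hχc, -⟩ := exists_continuous_one_zero_of_isCompact
    (isCompact_Icc (a := (0 : ℝ)) (b := 1)) isClosed_empty (Set.disjoint_empty _)
  let g : C_c(ℝ, ℝ) := ⟨⟨fun r => f r * χ r, hf.mul χ.continuous⟩, hχc.mul_left⟩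
  have hgf : ∀ r ∈ Set.Icc (0 : ℝ) 1, g r = f r := fun r hr => by
    change f r * χ r = f r
    rw [hχ1 hr, Pi.one_apply, mul_one]
  have hae : (g : ℝ → ℝ) =ᵐ[boundedSpectralMeasure R x] f := by
    filter_upwards [ae_mem_Icc_boundedSpectralMeasure h0 h1 x] with r hr using hgf r hr
  have hcfc : cfc (g : ℝ → ℝ) R = cfc f R :=
    cfc_congr fun r hr => hgf r (spectrum_subset_Icc h0 h1 hr)
  refine ⟨(g.continuous.integrable_of_hasCompactSupport g.hasCompactSupport).congr hae, ?_⟩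
  rw [← integral_congr_ae hae, ← hcfc]
  exact RealRMK.integral_rieszMeasure (spectralFunctional R x) g

theorem isProbabilityMeasure_boundedSpectralMeasure (h0 : 0 ≤ R) (h1 : R ≤ 1) {x : H}
    (hx : ‖x‖ = 1) : IsProbabilityMeasure (boundedSpectralMeasure R x) := by
  have hsa : IsSelfAdjoint R := IsSelfAdjoint.of_nonneg h0
  obtain ⟨hi, h⟩ := integral_boundedSpectralMeasure h0 h1 x (continuous_const (y := (1 : ℝ)))
  rw [cfc_const_one ℝ R] at h
  have h2 : (inner ℂ x ((1 : H →L[ℂ] H) x)).re = 1 := by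
    rw [one_apply_eq_self, inner_self_eq_norm_sq_to_K, hx]
    simp
  rw [h2, integral_const, smul_eq_mul, mul_one] at h
  have := (integrable_const_iff.mp hi).resolve_left one_ne_zero
  refine ⟨?_⟩
  rw [← ENNReal.toReal_eq_one_iff]
  exact h

/-- A point that is not an eigenvalue is not charged by the spectral measure. Hat functions of
width `1 / n` around `p` give operators which are contractions and, on the dense range of `R - p`,
tend to zero. -/
theorem boundedSpectralMeasure_singleton (h0 : 0 ≤ R) (h1 : R ≤ 1) (x : H) {p : ℝ}
    (hp : ∀ u, R u = (p : ℂ) • u → u = 0) : boundedSpectralMeasure R x {p} = 0 := by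
  have hsa : IsSelfAdjoint R := IsSelfAdjoint.of_nonneg h0
  let k : ℕ → ℝ → ℝ := fun n r => max 0 (1 - (n + 1) * |r - p|)
  have hk : ∀ n, Continuous (k n) := fun n => by fun_prop
  have hk0 : ∀ n r, 0 ≤ k n r := fun n r => le_max_left _ _
  have hk1 : ∀ n r, k n r ≤ 1 := fun n r =>
    max_le zero_le_one (by have : 0 ≤ (n + 1) * |r - p| := by positivity
                           linarith)
  have hkp : ∀ n r, |k n r * (r - p)| ≤ 1 / (n + 1) := by
    intro n r
    rw [abs_mul, abs_of_nonneg (hk0 n r), le_div_iff₀ (by positivity), mul_assoc]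
    rcases le_total (1 - (n + 1) * |r - p|) 0 with h | h
    · rw [show k n r = 0 from max_eq_left h, zero_mul]
      exact zero_le_one
    · have h3 : |r - p| * (n + 1) ≤ 1 := by linarith
      exact mul_le_one₀ (hk1 n r) (by positivity) h3
  let D : H →L[ℂ] H := cfc (fun r : ℝ => r - p) R
  have hD : ∀ u, D u = R u - (p : ℂ) • u := by
    intro u
    simp only [D]
    rw [cfc_sub (fun r : ℝ => r) (fun _ => p) R, cfc_id' ℝ R, cfc_const p R,
      Algebra.algebraMap_eq_smul_one, sub_apply, smul_apply, one_apply_eq_self,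
      RCLike.real_smul_eq_coe_smul (K := ℂ)]
    rfl
  have hdense : Dense ((LinearMap.range (D : H →ₗ[ℂ] H) : Submodule ℂ H) : Set H) := by
    rw [Submodule.dense_iff_topologicalClosure_eq_top, Submodule.topologicalClosure_eq_top_iff,
      ContinuousLinearMap.orthogonal_range, adjoint_cfc]
    refine (Submodule.eq_bot_iff _).mpr fun u hu => hp u ?_
    have : D u = 0 := hu
    rwa [hD, sub_eq_zero] at this
  have hlim : ∀ ε > 0, ∃ n, (inner ℂ x (cfc (k n) R x)).re ≤ ε := by
    intro ε hε
    obtain ⟨_, hw, w, rfl⟩ := Metric.dense_iff.mp hdense x (ε / (2 * (‖x‖ + 1))) (by positivity)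
    obtain ⟨n, hn⟩ := exists_nat_gt (2 * ‖x‖ * ‖w‖ / ε)
    refine ⟨n, ?_⟩
    rw [Metric.mem_ball, dist_eq_norm, norm_sub_rev] at hw
    change ‖x - D w‖ < _ at hw
    have h3 : ‖cfc (k n) R (x - D w)‖ ≤ ‖x - D w‖ := by
      refine (ContinuousLinearMap.le_of_opNorm_le _ (norm_cfc_le zero_le_one fun r _ => ?_) _).trans
        (one_mul _).le
      rw [Real.norm_of_nonneg (hk0 n r)]
      exact hk1 n r
    have h4 : ‖cfc (k n) R (D w)‖ ≤ 1 / (n + 1) * ‖w‖ := by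
      have : cfc (k n) R (D w) = cfc (fun r => k n r * (r - p)) R w := by
        rw [cfc_mul (k n) (fun r => r - p) R (hk n).continuousOn, mul_apply_eq_comp]
      rw [this]
      exact ContinuousLinearMap.le_of_opNorm_le _ (norm_cfc_le (by positivity) fun r _ => hkp n r) _
    have h5 : cfc (k n) R x = cfc (k n) R (x - D w) + cfc (k n) R (D w) := by
      rw [← map_add, sub_add_cancel]
    have h6 : ‖x‖ * (1 / (n + 1) * ‖w‖) ≤ ε / 2 := by
      rw [div_lt_iff₀ hε] at hn
      rw [← mul_assoc, mul_one_div, div_mul_eq_mul_div, div_le_iff₀ (by positivity)]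
      nlinarith
    have h7 : ‖x‖ * (ε / (2 * (‖x‖ + 1))) ≤ ε / 2 := by
      rw [← mul_div_assoc, div_le_iff₀ (by positivity)]
      nlinarith [norm_nonneg x]
    calc (inner ℂ x (cfc (k n) R x)).re ≤ ‖x‖ * ‖cfc (k n) R x‖ :=
          re_inner_le_norm (𝕜 := ℂ) _ _
      _ ≤ ‖x‖ * (‖x - D w‖ + 1 / (n + 1) * ‖w‖) := by
          gcongr
          rw [h5]
          exact (norm_add_le _ _).trans (add_le_add h3 h4)
      _ ≤ ‖x‖ * (ε / (2 * (‖x‖ + 1)) + 1 / (n + 1) * ‖w‖) := by gcongr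
      _ ≤ ε := by rw [mul_add]; linarith
  refine le_antisymm (ENNReal.le_of_forall_pos_le_add fun ε hε _ => ?_) bot_le
  obtain ⟨n, hn⟩ := hlim ε hε
  obtain ⟨hi, hint⟩ := integral_boundedSpectralMeasure h0 h1 x (hk n)
  rw [zero_add]
  calc boundedSpectralMeasure R x {p}
      = ∫⁻ r in {p}, ENNReal.ofReal (k n r) ∂boundedSpectralMeasure R x := by
        rw [lintegral_singleton]
        simp [k]
    _ ≤ ∫⁻ r, ENNReal.ofReal (k n r) ∂boundedSpectralMeasure R x := setLIntegral_le_lintegral _ _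
    _ = ENNReal.ofReal (inner ℂ x (cfc (k n) R x)).re := by
        rw [← ofReal_integral_eq_lintegral_ofReal hi (ae_of_all _ (hk0 n)), hint]
    _ ≤ ε := by
        rw [← ENNReal.ofReal_coe_nnreal]
        exact ENNReal.ofReal_le_ofReal hn

theorem ae_mem_Ioo_boundedSpectralMeasure (h0 : 0 ≤ R) (h1 : R ≤ 1)
    (hinj0 : ∀ u, R u = 0 → u = 0) (hinj1 : ∀ u, R u = u → u = 0) (x : H) :
    ∀ᵐ r ∂boundedSpectralMeasure R x, r ∈ Set.Ioo (0 : ℝ) 1 := by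
  have ha : ∀ᵐ r ∂boundedSpectralMeasure R x, r ≠ 0 :=
    measure_eq_zero_iff_ae_notMem.mp <|
      boundedSpectralMeasure_singleton h0 h1 x fun u hu => hinj0 u (by simpa using hu)
  have hb : ∀ᵐ r ∂boundedSpectralMeasure R x, r ≠ 1 :=
    measure_eq_zero_iff_ae_notMem.mp <|
      boundedSpectralMeasure_singleton h0 h1 x fun u hu => hinj1 u (by simpa using hu)
  filter_upwards [ha, hb, ae_mem_Icc_boundedSpectralMeasure h0 h1 x] with r hr0 hr1 hr
  exact ⟨lt_of_le_of_ne hr.1 hr0.symm, lt_of_le_of_ne hr.2 hr1⟩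

/-- If `x = R^(1/2) v`, then `⟪x, (R⁻¹ - 1) x⟫`, as an integral over the spectral measure, is at
most `‖(1 - R)^(1/2) v‖²`. The singular integrand is approximated by `(1 - r) / (r + ε)` with
`ε = 1 / (n + 1)`, which satisfies `r (1 - r) / (r + ε) ≤ 1 - r`; Fatou's lemma gives the bound. -/
theorem lintegral_inv_sub_one_le (h0 : 0 ≤ R) (h1 : R ≤ 1)
    (hinj0 : ∀ u, R u = 0 → u = 0) (hinj1 : ∀ u, R u = u → u = 0) (v : H) :
    ∫⁻ r, ENNReal.ofReal (r⁻¹ - 1) ∂boundedSpectralMeasure R (cfc Real.sqrt R v) ≤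
      ENNReal.ofReal (‖cfc (fun r : ℝ => Real.sqrt (1 - r)) R v‖ ^ 2) := by
  have hsa : IsSelfAdjoint R := IsSelfAdjoint.of_nonneg h0
  set x := cfc Real.sqrt R v
  -- The truncation `max r 0` makes the approximants continuous on all of `ℝ`.
  let f : ℕ → ℝ → ℝ := fun n r => (1 - r) / (max r 0 + 1 / (n + 1))
  have hpos : ∀ (n : ℕ) (r : ℝ), 0 < max r 0 + 1 / ((n : ℝ) + 1) := fun n r =>
    add_pos_of_nonneg_of_pos (le_max_right _ _) (by positivity)
  have hf : ∀ n, Continuous (f n) := fun n => by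
    refine Continuous.div (by fun_prop) (by fun_prop) fun r => (hpos n r).ne'
  have hae := ae_mem_Ioo_boundedSpectralMeasure h0 h1 hinj0 hinj1 x
  have hbound : ∀ n, ∫⁻ r, ENNReal.ofReal (f n r) ∂boundedSpectralMeasure R x ≤
      ENNReal.ofReal (‖cfc (fun r : ℝ => Real.sqrt (1 - r)) R v‖ ^ 2) := by
    intro n
    obtain ⟨hi, hint⟩ := integral_boundedSpectralMeasure h0 h1 x (hf n)
    have hn : 0 ≤ᵐ[boundedSpectralMeasure R x] f n := by
      filter_upwards [hae] with r hr
      exact div_nonneg (sub_nonneg.mpr hr.2.le) (hpos n r).le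
    rw [← ofReal_integral_eq_lintegral_ofReal hi hn, hint, norm_cfc_sqrt_one_sub_apply_sq h0 h1]
    refine ENNReal.ofReal_le_ofReal ?_
    have h3 : inner ℂ x (cfc (f n) R x) =
        inner ℂ v (cfc (fun r => Real.sqrt r * (f n r * Real.sqrt r)) R v) := by
      rw [cfc_mul Real.sqrt (fun r => f n r * Real.sqrt r) R Real.continuous_sqrt.continuousOn
          ((hf n).mul Real.continuous_sqrt).continuousOn,
        cfc_mul (f n) Real.sqrt R (hf n).continuousOn Real.continuous_sqrt.continuousOn,
        mul_apply_eq_comp, mul_apply_eq_comp,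
        ← ContinuousLinearMap.adjoint_inner_left (cfc Real.sqrt R), adjoint_cfc]
    rw [h3]
    have h4 : cfc (fun r => Real.sqrt r * (f n r * Real.sqrt r)) R ≤
        cfc (fun r : ℝ => 1 - r) R := by
      refine cfc_mono (fun r hr => ?_)
        (Real.continuous_sqrt.mul ((hf n).mul Real.continuous_sqrt)).continuousOn
      obtain ⟨hr0, hr1⟩ := spectrum_subset_Icc h0 h1 hr
      have : Real.sqrt r * (f n r * Real.sqrt r) = r * (1 - r) / (max r 0 + 1 / (n + 1)) := by
        rw [mul_comm (f n r), ← mul_assoc, Real.mul_self_sqrt hr0, mul_div_assoc]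
      rw [this, div_le_iff₀ (hpos n r), max_eq_left hr0, mul_comm]
      have : (0 : ℝ) ≤ 1 / (n + 1) := by positivity
      exact mul_le_mul_of_nonneg_left (by linarith) (by linarith)
    have h5 := ((ContinuousLinearMap.nonneg_iff_isPositive _).mp
      (sub_nonneg.mpr h4)).re_inner_nonneg_right v
    rw [sub_apply, inner_sub_right, map_sub] at h5
    exact sub_nonneg.mp h5
  have hlim : ∀ r ∈ Set.Ioo (0 : ℝ) 1,
      Tendsto (fun n => ENNReal.ofReal (f n r)) atTop (𝓝 (ENNReal.ofReal (r⁻¹ - 1))) := by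
    intro r hr
    refine ENNReal.tendsto_ofReal ?_
    have h6 : Tendsto (fun n : ℕ => r + 1 / ((n : ℝ) + 1)) atTop (𝓝 (r + 0)) :=
      tendsto_const_nhds.add tendsto_one_div_add_atTop_nhds_zero_nat
    have h7 := (tendsto_const_nhds (x := 1 - r)).div h6 (by simpa using hr.1.ne')
    have h8 : r⁻¹ - 1 = (1 - r) / (r + 0) := by
      rw [add_zero, sub_div, div_self hr.1.ne', one_div]
    rw [h8]
    refine h7.congr fun n => ?_
    simp only [f, Pi.div_apply, max_eq_left hr.1.le]
  calc ∫⁻ r, ENNReal.ofReal (r⁻¹ - 1) ∂boundedSpectralMeasure R x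
      = ∫⁻ r, liminf (fun n => ENNReal.ofReal (f n r)) atTop ∂boundedSpectralMeasure R x := by
        refine lintegral_congr_ae ?_
        filter_upwards [hae] with r hr using (hlim r hr).liminf_eq.symm
    _ ≤ liminf (fun n => ∫⁻ r, ENNReal.ofReal (f n r) ∂boundedSpectralMeasure R x) atTop :=
        lintegral_liminf_le fun n => (hf n).measurable.ennreal_ofReal
    _ ≤ _ := (liminf_le_liminf (Eventually.of_forall hbound)).trans (liminf_const _).le

end SpectralMeasure

/-! ### Jensen's inequality for the modular Hamiltonian -/

section ModularEnergy

variable {M : VonNeumannAlgebra H} {Ω : H}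

theorem modularEnergyMeasure_eq_map (x : H) :
    modularEnergyMeasure M Ω x =
      (boundedSpectralMeasure (invOneAdd (modularOperator M Ω)) x).map
        (fun r : ℝ => -Real.log (r⁻¹ - 1)) := by
  rw [modularEnergyMeasure, spectralMeasure, Measure.map_map (by fun_prop) (by fun_prop)]
  rfl

/-- Jensen's inequality `exp(-⟨K⟩) ≤ ⟨exp(-K)⟩ = ⟨Δ⟩` at the unit vector `R^(1/2) v`. The identity
`exp(log(r⁻¹ - 1)) = r⁻¹ - 1` fails at `r = 0` and at `r = 1`, where the logarithm has a junk value;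
neither point is charged. -/
theorem exp_neg_modularEnergy_le (hc : IsCyclic M Ω) (hs : IsSeparating M Ω) {v : H}
    (hv : ‖cfc Real.sqrt (invOneAdd (modularOperator M Ω)) v‖ = 1)
    (hfin : FiniteModularEnergy M Ω (cfc Real.sqrt (invOneAdd (modularOperator M Ω)) v)) :
    Real.exp (-modularEnergy M Ω (cfc Real.sqrt (invOneAdd (modularOperator M Ω)) v)) ≤
      ‖cfc (fun r : ℝ => Real.sqrt (1 - r)) (invOneAdd (modularOperator M Ω)) v‖ ^ 2 := by
  have h0 := invOneAdd_modularOperator_nonneg hc hs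
  have h1 := invOneAdd_modularOperator_le_one hc hs
  have hinj0 := fun u => eq_zero_of_invOneAdd_modularOperator_eq_zero hc hs (u := u)
  have hinj1 := fun u => eq_zero_of_invOneAdd_modularOperator_eq_self hc hs (u := u)
  rw [FiniteModularEnergy, modularEnergyMeasure_eq_map] at hfin
  rw [modularEnergy, modularEnergyMeasure_eq_map]
  set R := invOneAdd (modularOperator M Ω)
  set x := cfc Real.sqrt R v with hx
  have hmeas : Measurable fun r : ℝ => -Real.log (r⁻¹ - 1) := by fun_prop
  rw [integrable_map_measure (by fun_prop) hmeas.aemeasurable] at hfin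
  rw [integral_map hmeas.aemeasurable (by fun_prop)]
  have := isProbabilityMeasure_boundedSpectralMeasure h0 h1 hv
  have hae := ae_mem_Ioo_boundedSpectralMeasure h0 h1 hinj0 hinj1 x
  have hpos : ∀ r ∈ Set.Ioo (0 : ℝ) 1, 0 < r⁻¹ - 1 := fun r hr =>
    sub_pos.mpr ((one_lt_inv₀ hr.1).mpr hr.2)
  have hnn : 0 ≤ᵐ[boundedSpectralMeasure R x] fun r => r⁻¹ - 1 := by
    filter_upwards [hae] with r hr using (hpos r hr).le
  have hle := lintegral_inv_sub_one_le h0 h1 hinj0 hinj1 v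
  have hint : Integrable (fun r : ℝ => r⁻¹ - 1) (boundedSpectralMeasure R x) := by
    refine ⟨by fun_prop, ?_⟩
    rw [hasFiniteIntegral_iff_ofReal hnn]
    exact hle.trans_lt ENNReal.ofReal_lt_top
  have hexp : (fun r => Real.exp (Real.log (r⁻¹ - 1))) =ᵐ[boundedSpectralMeasure R x]
      fun r => r⁻¹ - 1 := by
    filter_upwards [hae] with r hr using Real.exp_log (hpos r hr)
  have hlog : Integrable (fun r : ℝ => Real.log (r⁻¹ - 1)) (boundedSpectralMeasure R x) := by
    simpa [Function.comp_def] using hfin.neg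
  have hJ := convexOn_exp.map_integral_le Real.continuous_exp.continuousOn isClosed_univ
    (ae_of_all _ fun _ => Set.mem_univ _) hlog (hint.congr hexp.symm)
  rw [integral_neg, neg_neg]
  refine hJ.trans ?_
  rw [integral_congr_ae hexp, integral_eq_lintegral_of_nonneg_ae hnn (by fun_prop)]
  exact ENNReal.toReal_le_of_le_ofReal (by positivity) hle

end ModularEnergy

end ModularTheory

theorem proposition1 {H : Type*} [NormedAddCommGroup H] [InnerProductSpace ℂ H] [CompleteSpace H]
    (M : VonNeumannAlgebra H) (Ω : H) (hΩ : ‖Ω‖ = 1)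
    (hcyc : ModularTheory.IsCyclic M Ω) (hsep : ModularTheory.IsSeparating M Ω)
    (A : H →L[ℂ] H) (hA : A ∈ M) :
    (∃ hξ : A Ω ∈ (ModularTheory.sqrtOp (ModularTheory.modularOperator M Ω)).domain,
      ‖ModularTheory.sqrtOp (ModularTheory.modularOperator M Ω) ⟨A Ω, hξ⟩‖ ≤ ‖A‖) ∧
    (A Ω ≠ 0 →
      ModularTheory.FiniteModularEnergy M Ω (((‖A Ω‖⁻¹ : ℝ) : ℂ) • A Ω) →
      ‖A Ω‖ * Real.exp (-(1 / 2 : ℝ) *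
        ModularTheory.modularEnergy M Ω (((‖A Ω‖⁻¹ : ℝ) : ℂ) • A Ω)) ≤ ‖A‖) := by
  obtain ⟨v, hv, hvn⟩ := ModularTheory.exists_cfc_sqrt_apply_eq hcyc hsep
    (subset_closure ⟨A, hA, rfl⟩ : (A Ω, star A Ω) ∈ ModularTheory.closedTomitaGraph M Ω)
  have hstar : ‖star A Ω‖ ≤ ‖A‖ := by
    simpa [hΩ] using (star A).le_opNorm Ω
  have hle := hvn.trans hstar
  refine ⟨?_, fun hne hfin => ?_⟩
  · have hg := ModularTheory.mk_mem_graph_sqrtOp hcyc hsep v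
    rw [hv] at hg
    have hξ := LinearPMap.mem_domain_of_mem_graph hg
    refine ⟨hξ, ?_⟩
    rwa [← (LinearPMap.image_iff hξ).mpr hg]
  · have hn : 0 < ‖A Ω‖ := norm_pos_iff.mpr hne
    set c : ℂ := ((‖A Ω‖⁻¹ : ℝ) : ℂ)
    have hc : ‖c‖ = ‖A Ω‖⁻¹ := by simp [c]
    rw [← hv, ← map_smul] at hfin
    have hJ := ModularTheory.exp_neg_modularEnergy_le hcyc hsep
      (by rw [map_smul, hv, norm_smul, hc, inv_mul_cancel₀ hn.ne']) hfin
    rw [map_smul, map_smul, hv, norm_smul, hc] at hJ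
    set E := ModularTheory.modularEnergy M Ω (c • A Ω)
    have hE : Real.exp (-(1 / 2 : ℝ) * E) ^ 2 = Real.exp (-E) := by
      rw [← Real.exp_nat_mul]
      congr 1
      push_cast
      ring
    rw [← hE] at hJ
    have h2 := le_of_abs_le (abs_le_of_sq_le_sq hJ (by positivity))
    rw [inv_mul_eq_div, le_div_iff₀ hn, mul_comm] at h2
    exact h2.trans hle
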